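/- Let $\Phi$ be a homogeneous Poisson point process in $\mathbb{R}^2$ with intensity $\lambda>0$, let $d>0$, and let $x_{\rm s},x_{\rm d}\in\mathbb{R}^2$ be two points at distance $2d$ from each other (for instance $x_{\rm s}=(-d,0)$ and $x_{\rm d}=(d,0)$). For a threshold $T\ge 0$ let $$N=\#\{X\in\Phi:\ \|x_{\rm s}-X\|\,\|X-x_{\rm d}\|\le T\}$$ be the number of points of $\Phi$ for which the product of the distances to $x_{\rm s}$ and $x_{\rm d}$ is at most $T$. Then $N$ is finite and integrable, and it is a Poisson random variable with mean $\Xi=\mathbb{E}[N]$ given by $$\Xi=\begin{cases}\dfrac{2\lambda}{d^2}\left(d^4E\!\left(\dfrac{T^2}{d^4}\right)+(T^2-d^4)K\!\left(\dfrac{T^2}{d^4}\right)\right) & \text{if } T\le d^2,\\[2ex] 2\lambda\,T\,E\!\left(\dfrac{d^4}{T^2}\right) & \text{if } T>d^2,\end{cases}$$ where $K(m)=\int_0^{\pi/2}(1-m\sin^2\theta)^{-1/2}\,d\theta$ and $E(m)=\int_0^{\pi/2}(1-m\sin^2\theta)^{1/2}\,d\theta$ are the complete elliptic integrals of the first and second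 kind as functions of the parameter $m$ (the square of the modulus). For $T=d^2$, where $K(1)=\infty$, the term $(T^2-d^4)K(T^2/d^4)$ is read as $0$. -/

import Mathlib

namespace RISFeedback

open MeasureTheory ProbabilityTheory

/-- The Euclidean plane. -/
abbrev Plane : Type := EuclideanSpace ℝ (Fin 2)

/-- Homogeneous Poisson point process of intensity `lam` in the plane, as a random locally finite
set of points: the numbers of points in bounded Borel sets are random variables, they are Poisson
distributed with mean `lam` times the area, and they are independent for pairwise disjoint sets. -/
structure IsHPPP {Ω : Type*} [MeasurableSpace Ω] (P : Measure Ω) (lam : ℝ)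
    (Φ : Ω → Set Plane) : Prop where
  locallyFinite : ∀ ω, ∀ B : Set Plane, Bornology.IsBounded B → (Φ ω ∩ B).Finite
  measurable_count : ∀ B : Set Plane, MeasurableSet B → Bornology.IsBounded B →
    Measurable (fun ω => (Φ ω ∩ B).ncard)
  hasLaw_count : ∀ B : Set Plane, MeasurableSet B → Bornology.IsBounded B →
    HasLaw (fun ω => (Φ ω ∩ B).ncard) (poissonMeasure (lam * volume.real B).toNNReal) P
  indep_count : ∀ (n : ℕ) (B : Fin n → Set Plane), (∀ i, MeasurableSet (B i)) →
    (∀ i, Bornology.IsBounded (B i)) → Pairwise (fun i j => Disjoint (B i) (B j)) →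
    iIndepFun (fun (i : Fin n) (ω : Ω) => (Φ ω ∩ B i).ncard) P

/-- Product of the distances from `x` to the transmitter `xs` and to the receiver `xd`. -/
noncomputable def distProd (xs xd x : Plane) : ℝ := ‖xs - x‖ * ‖x - xd‖

/-- The points of the configuration `φ` whose distance product is at most the threshold `T`. -/
def feedbackSet (xs xd : Plane) (T : ℝ) (φ : Set Plane) : Set Plane :=
  {x ∈ φ | distProd xs xd x ≤ T}

/-- The number of points of `φ` whose distance product is at most `T`. -/
noncomputable def feedbackCount (xs xd : Plane) (T : ℝ) (φ : Set Plane) : ℕ :=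
  (feedbackSet xs xd T φ).ncard

/-- The expected number of points of the random set `Φ` whose distance product is at most `T`. -/
noncomputable def feedbackMean {Ω : Type*} [MeasurableSpace Ω] (P : Measure Ω)
    (Φ : Ω → Set Plane) (xs xd : Plane) (T : ℝ) : ℝ :=
  ∫ ω, (feedbackCount xs xd T (Φ ω) : ℝ) ∂P

/-- Complete elliptic integral of the first kind, as a function of the parameter `m = k ^ 2`,
for `m < 1`. -/
noncomputable def ellipticK (m : ℝ) : ℝ :=
  ∫ θ in (0 : ℝ)..(Real.pi / 2), 1 / Real.sqrt (1 - m * Real.sin θ ^ 2)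

/-- Complete elliptic integral of the second kind, as a function of the parameter `m = k ^ 2`,
for `m ≤ 1`. -/
noncomputable def ellipticE (m : ℝ) : ℝ :=
  ∫ θ in (0 : ℝ)..(Real.pi / 2), Real.sqrt (1 - m * Real.sin θ ^ 2)

end RISFeedback

namespace RISFeedback

open MeasureTheory ProbabilityTheory Real Set
open scoped NNReal ENNReal

/-! ### The mean of a Poisson distribution -/

/-! The points counted are those in a closed bounded Cassini region, so their number is Poisson with
mean `lam` times its area. A rigid motion turns the region into |z² - d²| ≤ T in ℂ. In polar
coordinates, with φ = 2θ, this reads (r² - d² cos φ)² ≤ T² - d⁴ sin² φ, so r² ranges over an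
interval cut off at 0. The contributions of φ and φ + π add up to √(T² - d⁴ sin² φ), cut-offs
included (`cassiniRadial_add_antipode`). Hence one formula, 2∫√(T² - d⁴ sin² φ) over [0, π/2],
serves both regimes, as `√` is 0 on negatives. For T > d² this is an E-integral after pulling out T;
for T < d² the substitution sin φ = (T/d²) sin u yields E and K. -/

lemma hasSum_natCast_poisson (r : ℝ≥0) :
    HasSum (fun n : ℕ ↦ exp (-r) * r ^ n / n.factorial * (n : ℝ)) r := by
  -- The term n = 0 vanishes and n/n! = 1/(n-1)!, so the shifted series is r times the total mass.
  rw [← hasSum_nat_add_iff' 1]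
  have h := (hasSum_one_poissonMeasure r).mul_left (r : ℝ)
  simp only [Finset.range_one, Finset.sum_singleton, Nat.cast_zero, mul_zero, sub_zero, mul_one] at h ⊢
  refine h.congr_fun ?_
  intro n
  rw [Nat.factorial_succ]
  push_cast
  field_simp
  ring

lemma integrable_natCast_poissonMeasure (r : ℝ≥0) :
    Integrable (fun n : ℕ ↦ (n : ℝ)) (poissonMeasure r) := by
  rw [integrable_poissonMeasure_iff]
  simpa using (hasSum_natCast_poisson r).summable

lemma integral_natCast_poissonMeasure (r : ℝ≥0) :
    ∫ n : ℕ, (n : ℝ) ∂(poissonMeasure r) = r := by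
  rw [integral_poissonMeasure]
  simpa using (hasSum_natCast_poisson r).tsum_eq

/-! ### The area enclosed by a Cassini oval -/

lemma lintegral_id_Icc {a b : ℝ} (ha : 0 ≤ a) (hab : a ≤ b) :
    ∫⁻ r in Icc a b, ENNReal.ofReal r = ENNReal.ofReal ((b ^ 2 - a ^ 2) / 2) := by
  rw [← ofReal_integral_eq_lintegral_ofReal (f := fun r : ℝ ↦ r)
    continuous_id.integrableOn_Icc
    ((ae_restrict_mem measurableSet_Icc).mono fun x hx ↦ ha.trans hx.1),
    integral_Icc_eq_integral_Ioc, ← intervalIntegral.integral_of_le hab]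
  simp

/-- The condition says c - √D ≤ r² ≤ c + √D, and r dr = d(r²)/2. For D < 0 both sides are 0 because
`√D = 0`. -/
lemma lintegral_radial (c D : ℝ) :
    ∫⁻ r in Ioi (0 : ℝ), ENNReal.ofReal r * ({r : ℝ | (r ^ 2 - c) ^ 2 ≤ D}.indicator 1 r) =
      ENNReal.ofReal ((max (c + √D) 0 - max (c - √D) 0) / 2) := by
  have hmeas : MeasurableSet {r : ℝ | (r ^ 2 - c) ^ 2 ≤ D} :=
    measurableSet_le (by fun_prop) (by fun_prop)
  have h1 : ∀ r : ℝ, ENNReal.ofReal r * ({r : ℝ | (r ^ 2 - c) ^ 2 ≤ D}.indicator 1 r) =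
      {r : ℝ | (r ^ 2 - c) ^ 2 ≤ D}.indicator ENNReal.ofReal r := by
    intro r
    by_cases h : r ∈ {r : ℝ | (r ^ 2 - c) ^ 2 ≤ D} <;> simp [h]
  simp_rw [h1]
  rw [lintegral_indicator hmeas, Measure.restrict_restrict hmeas]
  rcases lt_or_ge D 0 with hD | hD
  · have : {r : ℝ | (r ^ 2 - c) ^ 2 ≤ D} = ∅ := by
      ext r
      simpa using hD.trans_le (sq_nonneg _)
    simp [this, sqrt_eq_zero_of_nonpos hD.le]
  · have hs := sqrt_nonneg D
    -- Negative radicands give endpoint 0, so the sets differ at most at r = 0.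
    have hae : ({r : ℝ | (r ^ 2 - c) ^ 2 ≤ D} ∩ Ioi 0 : Set ℝ) =ᵐ[volume]
        Icc (√(c - √D)) (√(c + √D)) := by
      have h2 : ({r : ℝ | (r ^ 2 - c) ^ 2 ≤ D} ∩ Ioi 0 : Set ℝ) =
          Icc (√(c - √D)) (√(c + √D)) ∩ Ioi 0 := by
        ext r
        simp only [mem_inter_iff, mem_ofPred_eq, mem_Ioi, mem_Icc, and_congr_left_iff]
        intro hr
        rw [Real.sq_le hD, sqrt_le_left hr.le, le_sqrt' hr]
        constructor <;> rintro ⟨h, h'⟩ <;> constructor <;> linarith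
      rw [h2]
      have h3 : Icc (√(c - √D)) (√(c + √D)) ∩ Ici 0 = Icc (√(c - √D)) (√(c + √D)) :=
        inter_eq_left.2 fun x hx ↦ (sqrt_nonneg _).trans hx.1
      conv_rhs => rw [← h3]
      exact (ae_eq_refl _).inter Ioi_ae_eq_Ici
    rw [setLIntegral_congr hae, lintegral_id_Icc (sqrt_nonneg _) (sqrt_le_sqrt (by linarith)),
      sq_sqrt', sq_sqrt']

lemma norm_polar_sq_sub_le_iff {d T : ℝ} (hT : 0 ≤ T) (r θ : ℝ) :
    ‖(r * (cos θ + sin θ * Complex.I) : ℂ) ^ 2 - d ^ 2‖ ≤ T ↔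
      (r ^ 2 - d ^ 2 * cos (2 * θ)) ^ 2 ≤ T ^ 2 - d ^ 4 * sin (2 * θ) ^ 2 := by
  rw [← sq_le_sq₀ (norm_nonneg _) hT, ← Complex.normSq_eq_norm_sq, Complex.normSq_apply]
  have hre : ((r * (cos θ + sin θ * Complex.I) : ℂ) ^ 2 - d ^ 2).re =
      r ^ 2 * cos (2 * θ) - d ^ 2 := by
    rw [cos_two_mul']
    simp [pow_two, -Complex.ofReal_cos, -Complex.ofReal_sin]
    ring
  have him : ((r * (cos θ + sin θ * Complex.I) : ℂ) ^ 2 - d ^ 2).im = r ^ 2 * sin (2 * θ) := by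
    rw [sin_two_mul]
    simp [pow_two, -Complex.ofReal_cos, -Complex.ofReal_sin]
    ring
  rw [hre, him]
  have h := sin_sq_add_cos_sq (2 * θ)
  have : (r ^ 2 * cos (2 * θ) - d ^ 2) * (r ^ 2 * cos (2 * θ) - d ^ 2) +
      r ^ 2 * sin (2 * θ) * (r ^ 2 * sin (2 * θ)) =
      (r ^ 2 - d ^ 2 * cos (2 * θ)) ^ 2 + d ^ 4 * sin (2 * θ) ^ 2 := by
    linear_combination (r ^ 4 - d ^ 4) * h
  rw [this, ← le_sub_iff_add_le]

/-- Half the squared radial extent of a Cassini oval in the direction `φ / 2`. -/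
noncomputable def cassiniRadial (d T φ : ℝ) : ℝ :=
  (max (d ^ 2 * cos φ + √(T ^ 2 - d ^ 4 * sin φ ^ 2)) 0 -
    max (d ^ 2 * cos φ - √(T ^ 2 - d ^ 4 * sin φ ^ 2)) 0) / 2

lemma continuous_cassiniRadial (d T : ℝ) : Continuous (cassiniRadial d T) := by
  unfold cassiniRadial
  fun_prop

lemma cassiniRadial_nonneg (d T φ : ℝ) : 0 ≤ cassiniRadial d T φ := by
  have h := sqrt_nonneg (T ^ 2 - d ^ 4 * sin φ ^ 2)
  have := max_le_max_right 0 (show d ^ 2 * cos φ - √(T ^ 2 - d ^ 4 * sin φ ^ 2) ≤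
    d ^ 2 * cos φ + √(T ^ 2 - d ^ 4 * sin φ ^ 2) by linarith)
  unfold cassiniRadial
  linarith

/-- Passing to φ + π negates and swaps the two roots, and x⁺ - (-x)⁺ = x removes the truncations. -/
lemma cassiniRadial_add_antipode (d T φ : ℝ) :
    cassiniRadial d T φ + cassiniRadial d T (φ + π) = √(T ^ 2 - d ^ 4 * sin φ ^ 2) := by
  unfold cassiniRadial
  rw [cos_add_pi, sin_add_pi, neg_sq]
  set s := √(T ^ 2 - d ^ 4 * sin φ ^ 2)
  have key : ∀ x : ℝ, max x 0 - max (-x) 0 = x := fun x ↦ by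
    rcases le_total x 0 with h | h
    · rw [max_eq_right h, max_eq_left (by linarith)]; ring
    · rw [max_eq_left h, max_eq_right (by linarith)]; ring
  have h1 := key (d ^ 2 * cos φ + s)
  have h2 := key (d ^ 2 * cos φ - s)
  rw [show d ^ 2 * -cos φ + s = -(d ^ 2 * cos φ - s) by ring,
    show d ^ 2 * -cos φ - s = -(d ^ 2 * cos φ + s) by ring]
  linarith

lemma volume_cassini_polar {d T : ℝ} (hT : 0 ≤ T) :
    volume {z : ℂ | ‖z ^ 2 - (d : ℂ) ^ 2‖ ≤ T} =
      ENNReal.ofReal (∫ θ in (-π)..π, cassiniRadial d T (2 * θ)) := by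
  have hS : MeasurableSet {z : ℂ | ‖z ^ 2 - (d : ℂ) ^ 2‖ ≤ T} :=
    measurableSet_le (by fun_prop) (by fun_prop)
  rw [← lintegral_indicator_one hS, ← Complex.lintegral_comp_polarCoord_symm, polarCoord_target,
    Measure.volume_eq_prod, setLIntegral_prod_symm]
  · have hinner : ∀ θ : ℝ, ∫⁻ r in Ioi (0 : ℝ), ENNReal.ofReal r •
        {z : ℂ | ‖z ^ 2 - (d : ℂ) ^ 2‖ ≤ T}.indicator (1 : ℂ → ℝ≥0∞)
          (Complex.polarCoord.symm (r, θ)) = ENNReal.ofReal (cassiniRadial d T (2 * θ)) := by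
      intro θ
      rw [cassiniRadial, ← lintegral_radial]
      refine lintegral_congr fun r ↦ ?_
      rw [smul_eq_mul]
      congr 1
      simp only [indicator_apply, mem_ofPred_eq, Complex.polarCoord_symm_apply]
      simp only [norm_polar_sq_sub_le_iff hT]
      rfl
    simp_rw [hinner]
    have hc : Continuous fun θ ↦ cassiniRadial d T (2 * θ) :=
      (continuous_cassiniRadial d T).comp (by fun_prop)
    rw [intervalIntegral.integral_of_le (by linarith [pi_pos]), integral_Ioc_eq_integral_Ioo,
      ofReal_integral_eq_lintegral_ofReal]
    · exact hc.integrableOn_Icc.mono_set Ioo_subset_Icc_self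
    · exact ae_of_all _ fun θ ↦ cassiniRadial_nonneg d T _
  · refine Measurable.aemeasurable ?_
    simp only [Complex.polarCoord_symm_apply, smul_eq_mul]
    exact (by fun_prop : Measurable fun p : ℝ × ℝ ↦ ENNReal.ofReal p.1).mul
      ((measurable_one.indicator hS).comp (by fun_prop))

/-- φ = 2θ covers two periods, offsetting the Jacobian 1/2. Pairing antipodes folds one period onto
[0, π], and φ ↦ π - φ halves that. -/
lemma integral_cassiniRadial (d T : ℝ) :
    ∫ θ in (-π)..π, cassiniRadial d T (2 * θ) =
      2 * ∫ φ in (0 : ℝ)..(π / 2), √(T ^ 2 - d ^ 4 * sin φ ^ 2) := by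
  have hg := continuous_cassiniRadial d T
  have hg' : Continuous fun φ ↦ cassiniRadial d T (φ + π) := hg.comp (continuous_add_const π)
  have hs : Continuous fun φ ↦ √(T ^ 2 - d ^ 4 * sin φ ^ 2) := by fun_prop
  have hper : Function.Periodic (cassiniRadial d T) (2 * π) := fun φ ↦ by
    simp [cassiniRadial]
  have h1 := hper.intervalIntegral_add_eq (2 * -π) 0
  rw [show 2 * -π + 2 * π = 0 by ring, zero_add] at h1
  rw [intervalIntegral.integral_comp_mul_left _ two_ne_zero,
    ← intervalIntegral.integral_add_adjacent_intervals (hg.intervalIntegrable _ 0)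
      (hg.intervalIntegrable 0 _), h1]
  have h2 : ∫ φ in (0 : ℝ)..(2 * π), cassiniRadial d T φ =
      ∫ φ in (0 : ℝ)..π, √(T ^ 2 - d ^ 4 * sin φ ^ 2) := by
    have h3 := intervalIntegral.integral_comp_add_right (a := 0) (b := π) (cassiniRadial d T) π
    rw [zero_add, ← two_mul] at h3
    rw [← intervalIntegral.integral_add_adjacent_intervals (hg.intervalIntegrable _ π)
      (hg.intervalIntegrable π _), ← h3, ← intervalIntegral.integral_add
      (hg.intervalIntegrable _ _)
      (hg'.intervalIntegrable _ _)]
    simp_rw [cassiniRadial_add_antipode]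
  have h4 := intervalIntegral.integral_comp_sub_left (a := 0) (b := π / 2)
    (fun φ ↦ √(T ^ 2 - d ^ 4 * sin φ ^ 2)) π
  simp only [sin_pi_sub, sub_zero] at h4
  rw [show π - π / 2 = π / 2 by ring] at h4
  rw [h2, ← intervalIntegral.integral_add_adjacent_intervals (hs.intervalIntegrable _ (π / 2))
      (hs.intervalIntegrable (π / 2) _), ← h4]
  simp only [smul_eq_mul]
  ring

lemma volume_real_cassini {d T : ℝ} (hT : 0 ≤ T) :
    volume.real {z : ℂ | ‖z ^ 2 - (d : ℂ) ^ 2‖ ≤ T} =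
      2 * ∫ φ in (0 : ℝ)..(π / 2), √(T ^ 2 - d ^ 4 * sin φ ^ 2) := by
  rw [measureReal_def, volume_cassini_polar hT, integral_cassiniRadial, ENNReal.toReal_ofReal]
  exact mul_nonneg zero_le_two
    (intervalIntegral.integral_nonneg (by positivity) fun _ _ ↦ sqrt_nonneg _)

/-! ### Reduction to complete elliptic integrals -/

lemma integral_sqrt_eq_ellipticE {d T : ℝ} (hT : 0 < T) :
    ∫ φ in (0 : ℝ)..(π / 2), √(T ^ 2 - d ^ 4 * sin φ ^ 2) = T * ellipticE (d ^ 4 / T ^ 2) := by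
  rw [ellipticE, ← intervalIntegral.integral_const_mul]
  congr 1 with φ
  rw [show T ^ 2 - d ^ 4 * sin φ ^ 2 = T ^ 2 * (1 - d ^ 4 / T ^ 2 * sin φ ^ 2) by field_simp,
    sqrt_mul (sq_nonneg T), sqrt_sq hT.le]

lemma integral_sqrt_truncate {k : ℝ} (hk0 : 0 ≤ k) (hk1 : k ≤ 1) :
    ∫ φ in (0 : ℝ)..(π / 2), √(k ^ 2 - sin φ ^ 2) =
      ∫ φ in (0 : ℝ)..(arcsin k), √(k ^ 2 - sin φ ^ 2) := by
  have hs : Continuous fun φ ↦ √(k ^ 2 - sin φ ^ 2) := by fun_prop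
  rw [← intervalIntegral.integral_add_adjacent_intervals (hs.intervalIntegrable _ (arcsin k))
      (hs.intervalIntegrable (arcsin k) _), add_eq_left]
  refine intervalIntegral.integral_zero_ae (ae_of_all _ fun φ hφ ↦ ?_)
  rw [uIoc_of_le (arcsin_le_pi_div_two k)] at hφ
  refine sqrt_eq_zero_of_nonpos (sub_nonpos.2 (pow_le_pow_left₀ hk0 ?_ 2))
  rw [← arcsin_le_iff_le_sin ⟨by linarith, hk1⟩
    ⟨by linarith [hφ.1, arcsin_nonneg.2 hk0, pi_pos], hφ.2⟩]
  exact hφ.1.le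

/-- With Δ = √(1 - k² sin² u), substituting φ = arcsin (k sin u) gives the integrand k² cos² u / Δ =
Δ + (k² - 1)/Δ. -/
lemma integral_sqrt_eq_elliptic {k : ℝ} (hk0 : 0 ≤ k) (hk1 : k < 1) :
    ∫ φ in (0 : ℝ)..(π / 2), √(k ^ 2 - sin φ ^ 2) =
      ellipticE (k ^ 2) + (k ^ 2 - 1) * ellipticK (k ^ 2) := by
  have hlt : ∀ u, (k * sin u) ^ 2 < 1 := fun u ↦ by
    have := sin_sq_le_one u
    have : k ^ 2 < 1 := by nlinarith
    nlinarith [sq_nonneg k]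
  have hpos : ∀ u, 0 < 1 - k ^ 2 * sin u ^ 2 := fun u ↦ by
    have := hlt u
    rw [mul_pow] at this
    linarith
  have hne : ∀ u, √(1 - k ^ 2 * sin u ^ 2) ≠ 0 := fun u ↦ (sqrt_pos.2 (hpos u)).ne'
  have hderiv : ∀ u, HasDerivAt (fun u ↦ arcsin (k * sin u))
      (k * cos u / √(1 - k ^ 2 * sin u ^ 2)) u := fun u ↦ by
    have h := abs_lt.1 ((sq_lt_one_iff_abs_lt_one _).1 (hlt u))
    convert! (hasDerivAt_arcsin h.1.ne' h.2.ne).comp u ((hasDerivAt_sin u).const_mul k) using 1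
    rw [mul_pow]
    ring
  have hcont : Continuous fun u ↦ k * cos u / √(1 - k ^ 2 * sin u ^ 2) :=
    Continuous.div (by fun_prop) (by fun_prop) hne
  have hsub := intervalIntegral.integral_comp_mul_deriv (a := 0) (b := π / 2)
    (g := fun φ ↦ √(k ^ 2 - sin φ ^ 2)) (fun u _ ↦ hderiv u) hcont.continuousOn (by fun_prop)
  simp only [sin_zero, mul_zero, arcsin_zero, sin_pi_div_two, mul_one] at hsub
  rw [integral_sqrt_truncate hk0 hk1.le, ← hsub, ellipticE, ellipticK,
    ← intervalIntegral.integral_const_mul, ← intervalIntegral.integral_add]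
  · refine intervalIntegral.integral_congr fun u hu ↦ ?_
    rw [uIcc_of_le (by positivity)] at hu
    have hcos : 0 ≤ cos u := cos_nonneg_of_mem_Icc ⟨by linarith [hu.1, pi_pos], hu.2⟩
    have h := abs_lt.1 ((sq_lt_one_iff_abs_lt_one _).1 (hlt u))
    have hsqrt : √(k ^ 2 - (k * sin u) ^ 2) = k * cos u := by
      rw [show k ^ 2 - (k * sin u) ^ 2 = (k * cos u) ^ 2 by
        linear_combination k ^ 2 * (sin_sq_add_cos_sq u).symm]
      exact sqrt_sq (by positivity)
    simp only [Function.comp_apply, sin_arcsin h.1.le h.2.le, hsqrt]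
    have := hne u
    field_simp
    rw [sq_sqrt (hpos u).le]
    linear_combination k ^ 2 * sin_sq_add_cos_sq u
  · exact Continuous.intervalIntegrable (by fun_prop) _ _
  · exact (continuous_const.mul
      (continuous_const.div (by fun_prop) hne)).intervalIntegrable _ _

lemma integral_sqrt_eq_elliptic_of_le {d T : ℝ} (hd : 0 < d) (hT : 0 ≤ T) (hTd : T ≤ d ^ 2) :
    ∫ φ in (0 : ℝ)..(π / 2), √(T ^ 2 - d ^ 4 * sin φ ^ 2) =
      1 / d ^ 2 * (d ^ 4 * ellipticE (T ^ 2 / d ^ 4) +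
        (T ^ 2 - d ^ 4) * ellipticK (T ^ 2 / d ^ 4)) := by
  rcases hTd.eq_or_lt with rfl | hlt
  -- At T = d² the coefficient of `ellipticK 1` is 0, so its value is irrelevant.
  · rw [integral_sqrt_eq_ellipticE (by positivity), show (d ^ 2) ^ 2 = d ^ 4 by ring]
    field_simp
    ring
  · have h := integral_sqrt_eq_elliptic (k := T / d ^ 2) (by positivity)
      ((div_lt_one (by positivity)).2 hlt)
    have hk : (T / d ^ 2) ^ 2 = T ^ 2 / d ^ 4 := by rw [div_pow]; ring
    have hscale : ∀ φ : ℝ, √(T ^ 2 - d ^ 4 * sin φ ^ 2) =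
        d ^ 2 * √((T / d ^ 2) ^ 2 - sin φ ^ 2) := fun φ ↦ by
      rw [hk, show T ^ 2 - d ^ 4 * sin φ ^ 2 = (d ^ 2) ^ 2 * (T ^ 2 / d ^ 4 - sin φ ^ 2) by
        field_simp, sqrt_mul (sq_nonneg _), sqrt_sq (sq_nonneg d)]
    simp_rw [hscale]
    rw [intervalIntegral.integral_const_mul, h, hk]
    field_simp

/-! ### The feedback region -/

/-- The region of the plane where the distance product is at most `T`. -/
def feedbackRegion (xs xd : Plane) (T : ℝ) : Set Plane := {x | distProd xs xd x ≤ T}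

lemma isClosed_feedbackRegion (xs xd : Plane) (T : ℝ) : IsClosed (feedbackRegion xs xd T) := by
  unfold feedbackRegion distProd
  exact isClosed_le (by fun_prop) continuous_const

lemma isBounded_feedbackRegion (xs xd : Plane) (T : ℝ) :
    Bornology.IsBounded (feedbackRegion xs xd T) := by
  rw [isBounded_iff_forall_norm_le]
  -- Beyond this radius both distances exceed |T| + 1, hence their product exceeds T.
  refine ⟨‖xs‖ + ‖xd‖ + |T| + 1, fun x hx ↦ ?_⟩
  have hx' : ‖xs - x‖ * ‖x - xd‖ ≤ T := hx
  by_contra! hcon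
  have h1 : ‖x‖ ≤ ‖xs‖ + ‖xs - x‖ := by
    simpa using norm_sub_le xs (xs - x)
  have h2 : ‖x‖ ≤ ‖xd‖ + ‖x - xd‖ := by
    simpa using norm_add_le xd (x - xd)
  have := norm_nonneg xs
  have := norm_nonneg xd
  have := abs_nonneg T
  have := le_abs_self T
  nlinarith

lemma volume_real_feedbackRegion {d T : ℝ} (hd : 0 < d) (hT : 0 ≤ T) {xs xd : Plane}
    (hdist : dist xs xd = 2 * d) :
    volume.real (feedbackRegion xs xd T) =
      2 * ∫ φ in (0 : ℝ)..(π / 2), √(T ^ 2 - d ^ 4 * sin φ ^ 2) := by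
  let e : ℂ ≃ₗᵢ[ℝ] Plane := Complex.orthonormalBasisOneI.repr
  -- The unit direction from `xd` to `xs`: rotating by it and moving 0 to the midpoint sends d to
  -- `xs` and -d to `xd`.
  let w : ℂ := e.symm (xs - xd) / (2 * d)
  have hd' : (d : ℂ) ≠ 0 := Complex.ofReal_ne_zero.2 hd.ne'
  have hw : ‖w‖ = 1 := by
    simp only [w, norm_div, LinearIsometryEquiv.norm_map, ← dist_eq_norm, hdist, norm_mul,
      Complex.norm_real, Complex.norm_ofNat, norm_eq_abs, abs_of_pos hd]
    field_simp
  let u : Circle := ⟨w, mem_sphere_zero_iff_norm.2 hw⟩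
  let F : ℂ → Plane := fun z ↦ e (rotation u z) + (2⁻¹ : ℝ) • (xs + xd)
  have hFw : ∀ z, F z = e (w * z) + (2⁻¹ : ℝ) • (xs + xd) := fun _ ↦ rfl
  have hF : MeasurePreserving F :=
    (measurePreserving_add_right volume _).comp
      (e.measurePreserving.comp (rotation u).measurePreserving)
  have hew : e (w * d) = (2⁻¹ : ℝ) • (xs - xd) := by
    apply e.symm.injective
    rw [e.symm_apply_apply, map_smul, Complex.real_smul]
    simp only [w]
    push_cast
    field_simp
  have hs : ∀ z, ‖xs - F z‖ = ‖z - d‖ := fun z ↦ by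
    have : xs - F z = e (w * (d - z)) := by
      rw [mul_sub, map_sub, hew]
      rw [hFw]
      module
    rw [this, e.norm_map, norm_mul, hw, one_mul, norm_sub_rev]
  have hd2 : ∀ z, ‖F z - xd‖ = ‖z + d‖ := fun z ↦ by
    have : F z - xd = e (w * (z + d)) := by
      rw [mul_add, map_add, hew]
      rw [hFw]
      module
    rw [this, e.norm_map, norm_mul, hw, one_mul]
  have hpre : F ⁻¹' feedbackRegion xs xd T = {z : ℂ | ‖z ^ 2 - (d : ℂ) ^ 2‖ ≤ T} := by
    ext z
    change ‖xs - F z‖ * ‖F z - xd‖ ≤ T ↔ ‖z ^ 2 - (d : ℂ) ^ 2‖ ≤ T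
    rw [hs, hd2, ← norm_mul, show (z - d) * (z + d) = z ^ 2 - (d : ℂ) ^ 2 by ring]
  rw [← volume_real_cassini hT, ← hpre, measureReal_def, measureReal_def,
    hF.measure_preimage (isClosed_feedbackRegion xs xd T).measurableSet.nullMeasurableSet]

lemma IsHPPP.hasLaw_feedbackCount {Ω : Type*} [MeasurableSpace Ω] {P : Measure Ω} {lam : ℝ}
    {Φ : Ω → Set Plane} (hΦ : IsHPPP P lam Φ) (xs xd : Plane) (T : ℝ) :
    HasLaw (fun ω ↦ feedbackCount xs xd T (Φ ω))
      (poissonMeasure (lam * volume.real (feedbackRegion xs xd T)).toNNReal) P :=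
  hΦ.hasLaw_count _ (isClosed_feedbackRegion xs xd T).measurableSet
    (isBounded_feedbackRegion xs xd T)

lemma IsHPPP.integrable_feedbackCount {Ω : Type*} [MeasurableSpace Ω] {P : Measure Ω} {lam : ℝ}
    {Φ : Ω → Set Plane} (hΦ : IsHPPP P lam Φ) (xs xd : Plane) (T : ℝ) :
    Integrable (fun ω ↦ (feedbackCount xs xd T (Φ ω) : ℝ)) P := by
  have hlaw := hΦ.hasLaw_feedbackCount xs xd T
  have h := integrable_natCast_poissonMeasure
    (lam * volume.real (feedbackRegion xs xd T)).toNNReal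
  rw [← hlaw.map_eq] at h
  exact h.comp_aemeasurable hlaw.aemeasurable

lemma IsHPPP.feedbackMean_eq {Ω : Type*} [MeasurableSpace Ω] {P : Measure Ω} {lam : ℝ}
    (hlam : 0 ≤ lam) {Φ : Ω → Set Plane} (hΦ : IsHPPP P lam Φ) (xs xd : Plane) (T : ℝ) :
    feedbackMean P Φ xs xd T = lam * volume.real (feedbackRegion xs xd T) := by
  have hlaw := hΦ.hasLaw_feedbackCount xs xd T
  have h := hlaw.integral_comp (f := fun n : ℕ ↦ (n : ℝ)) .of_discrete
  rw [integral_natCast_poissonMeasure, coe_toNNReal _ (by positivity)] at h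
  exact h

end RISFeedback

theorem theorem3 {Ω : Type*} [MeasurableSpace Ω] (P : MeasureTheory.Measure Ω)
    [MeasureTheory.IsProbabilityMeasure P] (lam : ℝ) (hlam : 0 < lam)
    (Φ : Ω → Set RISFeedback.Plane) (hΦ : RISFeedback.IsHPPP P lam Φ)
    (d : ℝ) (hd : 0 < d) (xs xd : RISFeedback.Plane) (hdist : dist xs xd = 2 * d)
    (T : ℝ) (hT : 0 ≤ T) :
    (∀ ω, (RISFeedback.feedbackSet xs xd T (Φ ω)).Finite) ∧
    MeasureTheory.Integrable (fun ω => (RISFeedback.feedbackCount xs xd T (Φ ω) : ℝ)) P ∧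
    ProbabilityTheory.HasLaw (fun ω => RISFeedback.feedbackCount xs xd T (Φ ω))
      (ProbabilityTheory.poissonMeasure (RISFeedback.feedbackMean P Φ xs xd T).toNNReal) P ∧
    (T ≤ d ^ 2 → RISFeedback.feedbackMean P Φ xs xd T =
      2 * lam * (1 / d ^ 2 * (d ^ 4 * RISFeedback.ellipticE (T ^ 2 / d ^ 4) +
        (T ^ 2 - d ^ 4) * RISFeedback.ellipticK (T ^ 2 / d ^ 4)))) ∧
    (d ^ 2 < T → RISFeedback.feedbackMean P Φ xs xd T =
      2 * lam * (T * RISFeedback.ellipticE (d ^ 4 / T ^ 2))) := by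
  have hmean := hΦ.feedbackMean_eq hlam.le xs xd T
  have hvol := RISFeedback.volume_real_feedbackRegion hd hT hdist
  refine ⟨fun ω ↦ hΦ.locallyFinite ω _ (RISFeedback.isBounded_feedbackRegion xs xd T),
    hΦ.integrable_feedbackCount xs xd T, ?_, fun hTd ↦ ?_, fun hTd ↦ ?_⟩
  · rw [hmean]
    exact hΦ.hasLaw_feedbackCount xs xd T
  · rw [hmean, hvol, RISFeedback.integral_sqrt_eq_elliptic_of_le hd hT hTd]
    ring
  · rw [hmean, hvol, RISFeedback.integral_sqrt_eq_ellipticE ((by positivity : 0 < d ^ 2).trans hTd)]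
    ring
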